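/- Work in the guarded $\lambda$-calculus $\mathsf{g}\lambda$. Its (closed) types are built from $\mathbf N$, $\mathbf 1$, $\times$, $\mathbf 0$, $+$, $\to$, guarded recursive types $\mu\alpha.A$ (every occurrence of $\alpha$ in $A$ lies beneath a $\blacktriangleright$), the later modality $\blacktriangleright$, and the modality $\blacksquare$, which is applied to closed types only. Its terms are those of the simply typed $\lambda$-calculus with natural numbers, products, sums and iso-recursive types ($\mathsf{fold}$, $\mathsf{unfold}$), together with $\mathsf{next}$, $\circledast$, $\mathsf{prev}$, $\mathsf{box}$, $\mathsf{unbox}$ and $\mathsf{box}^+$. Types and typed terms $\Gamma\vdash t:A$ are interpreted as objects and arrows $[\![t]\!]:[\![\Gamma]\!]\to[\![A]\!]$ of the topos of trees, the category of presheaves on $\omega$. The logic $L\mathsf{g}\lambda$ is the internal logic of this topos: a proposition in context $\Gamma$ is a subobject of $[\![\Gamma]\!]$; the proposition $t=_A u$ is the subobject of those elements on which $[\![t]\!]$ and $[\![u]\!]$ agree; and for a set $\Xi$ of propositions, $\Gamma\mid\Xi\vdash\varphi$ means that the intersection of the members of $\Xi$ is contained in $\varphi$. For a type $A$, the guarded Turing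 fixed point combinator $\mathsf{fix}:(\blacktriangleright A\to A)\to A$ is \[ \begin{aligned} \mathsf{Rec}_A &= \mu\alpha.\,(\blacktriangleright\alpha\to(\blacktriangleright A\to A)\to A),\\ \theta &= \lambda y.\lambda f.\,f\bigl((\mathsf{next}\,\lambda z.\,\mathsf{unfold}\,z)\circledast y\circledast\mathsf{next}\,y\circledast\mathsf{next}\,f\bigr) : \blacktriangleright\mathsf{Rec}_A\to(\blacktriangleright A\to A)\to A,\\ \mathsf{fix} &= \theta\,(\mathsf{next}\,\mathsf{fold}\,\theta). \end{aligned} \] **Lemma.** Let $\Gamma$ be a context, $A$ a type and $\Gamma\vdash f:\blacktriangleright A\to A$ a term. Then \[ \Gamma\mid\emptyset\vdash \mathsf{fix}\,f =_A f(\mathsf{next}(\mathsf{fix}\,f)). \] Moreover, $\mathsf{fix}\,f$ is the unique such solution: for every term $\Gamma\vdash u:A$ and every set $\Xi$ of propositions in context $\Gamma$, if $\Gamma\mid\Xi\vdash f(\mathsf{next}\,u)=_A u$ then $\Gamma\mid\Xi\vdash u=_A\mathsf{fix}\,f$. -/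

import Mathlib

/-! # The guarded lambda-calculus, the topos of trees, and its internal equality logic -/

namespace GLam

/-! ## The topos of trees

Stages are indexed by `ℕ` starting at `0` instead of by the positive integers. -/

/-- An object of the topos of trees: a family of sets with restriction functions. -/
@[ext]
structure Tree where
  obj : ℕ → Type
  res : ∀ i, obj (i + 1) → obj i

/-- An arrow of the topos of trees: a natural family of functions. -/
@[ext]
structure Hom (X Y : Tree) where
  app : ∀ i, X.obj i → Y.obj i
  natural : ∀ i (x : X.obj (i + 1)), app i (X.res i x) = Y.res i (app (i + 1) x)

namespace Tree

/-- The iterated restriction `X_i → X_j` for `j ≤ i`. -/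
def restr (X : Tree) {j i : ℕ} (h : j ≤ i) : X.obj i → X.obj j :=
  Nat.leRec (motive := fun k _ => X.obj k → X.obj j) id (fun k _ r => r ∘ X.res k) h

theorem restr_self (X : Tree) (i : ℕ) (x : X.obj i) : X.restr (le_refl i) x = x := by
  simp [restr]

theorem restr_succ (X : Tree) {j i : ℕ} (h : j ≤ i) (x : X.obj (i + 1)) :
    X.restr (Nat.le_succ_of_le h) x = X.restr h (X.res i x) := by
  rw [restr, Nat.leRec_succ _ _ h]; rfl

theorem res_restr (X : Tree) {j i : ℕ} (h : j + 1 ≤ i) (x : X.obj i) :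
    X.res j (X.restr h x) = X.restr (Nat.le_of_succ_le h) x := by
  induction i, h using Nat.le_induction with
  | base =>
    rw [restr_self, restr_succ X (le_refl j), restr_self]
  | succ i h ih =>
    rw [restr_succ X h, ih, restr_succ X (Nat.le_of_succ_le h)]

/-- The constant object on a set. -/
def const (Z : Type) : Tree where
  obj _ := Z
  res _ := id

/-- The binary product. -/
def prod (X Y : Tree) : Tree where
  obj i := X.obj i × Y.obj i
  res i := Prod.map (X.res i) (Y.res i)

/-- The binary coproduct. -/
def sum (X Y : Tree) : Tree where
  obj i := X.obj i ⊕ Y.obj i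
  res i := Sum.map (X.res i) (Y.res i)

/-- The exponential `Y ^ X`: at stage `i`, tuples of functions `X_j → Y_j` for `j ≤ i`
that commute with the restriction functions. -/
def exp (X Y : Tree) : Tree where
  obj i := {f : ∀ j, j ≤ i → X.obj j → Y.obj j //
    ∀ j (h : j + 1 ≤ i) (x : X.obj (j + 1)),
      f j (Nat.le_of_succ_le h) (X.res j x) = Y.res j (f (j + 1) h x)}
  res i f := ⟨fun j h => f.1 j (Nat.le_succ_of_le h),
    fun j h => f.2 j (Nat.le_succ_of_le h)⟩

/-- The sets of `▶ X`: a singleton, followed by the sets of `X`. -/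
def laterObj (X : Tree) : ℕ → Type
  | 0 => Unit
  | i + 1 => X.obj i

/-- The restriction functions of `▶ X`. -/
def laterRes (X : Tree) : ∀ i, X.laterObj (i + 1) → X.laterObj i
  | 0 => fun _ => ()
  | i + 1 => X.res i

/-- The functor `▶` on objects. -/
def later (X : Tree) : Tree where
  obj := X.laterObj
  res := X.laterRes

/-- The global elements `1 → X`, concretely: the compatible sequences. -/
def Global (X : Tree) : Type :=
  {x : ∀ i, X.obj i // ∀ i, X.res i (x (i + 1)) = x i}

/-- The functor `■` on objects: the constant object of global elements. -/
def box (X : Tree) : Tree := const X.Global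

/-- Constant objects: all restriction functions are bijections. -/
def IsConst (X : Tree) : Prop := ∀ i, Function.Bijective (X.res i)

/-- In a constant object each element at each stage extends to exactly one global element. -/
theorem IsConst.existsUnique {X : Tree} (hX : X.IsConst) (i : ℕ) (x : X.obj i) :
    ∃! g : X.Global, g.1 i = x := by
  have inj : ∀ g g' : X.Global, g.1 0 = g'.1 0 → g = g' := by
    intro g g' h
    apply Subtype.ext
    funext j
    induction j with
    | zero => exact h
    | succ j ih => exact (hX j).1 (by rw [g.2, g'.2, ih])
  have down : ∀ (g : X.Global) j, X.restr (Nat.zero_le j) (g.1 j) = g.1 0 := by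
    intro g j
    induction j with
    | zero => exact X.restr_self 0 _
    | succ j ih => rw [X.restr_succ (Nat.zero_le j), g.2, ih]
  have rinj : ∀ j, Function.Injective (X.restr (Nat.zero_le j)) := by
    intro j
    induction j with
    | zero => intro a b h; rwa [X.restr_self, X.restr_self] at h
    | succ j ih =>
      intro a b h
      rw [X.restr_succ (Nat.zero_le j), X.restr_succ (Nat.zero_le j)] at h
      exact (hX j).1 (ih h)
  let y : ∀ j, X.obj j := fun j => Nat.rec (motive := X.obj) (X.restr (Nat.zero_le i) x)
    (fun k z => ((hX k).2 z).choose) j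
  have hy : ∀ j, X.res j (y (j + 1)) = y j := fun j => ((hX j).2 (y j)).choose_spec
  refine ⟨⟨y, hy⟩, rinj i (down ⟨y, hy⟩ i), ?_⟩
  intro g hg
  apply inj
  change g.1 0 = X.restr (Nat.zero_le i) x
  rw [← down g i, hg]

/-- The global element of a constant object through a given element at stage `i`; its
components are what one obtains from `x` by the inverses of the restriction bijections. -/
noncomputable def IsConst.global {X : Tree} (hX : X.IsConst) (i : ℕ) (x : X.obj i) :
    X.Global := (hX.existsUnique i x).choose

theorem IsConst.global_spec {X : Tree} (hX : X.IsConst) (i : ℕ) (x : X.obj i) :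
    (hX.global i x).1 i = x := (hX.existsUnique i x).choose_spec.1

theorem IsConst.global_res {X : Tree} (hX : X.IsConst) (i : ℕ) (x : X.obj (i + 1)) :
    hX.global i (X.res i x) = hX.global (i + 1) x := by
  apply (hX.existsUnique i (X.res i x)).unique (hX.global_spec _ _)
  rw [← (hX.global (i + 1) x).2, hX.global_spec]

theorem isConst_const (Z : Type) : (const Z).IsConst := fun _ => Function.bijective_id

theorem IsConst.prod {X Y : Tree} (hX : X.IsConst) (hY : Y.IsConst) : (prod X Y).IsConst :=
  fun i => (hX i).prodMap (hY i)

theorem IsConst.sum {X Y : Tree} (hX : X.IsConst) (hY : Y.IsConst) : (sum X Y).IsConst :=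
  fun i => ⟨(hX i).1.sumMap (hY i).1, (hX i).2.sumMap (hY i).2⟩

theorem IsConst.exp {X Y : Tree} (hY : Y.IsConst) : (exp X Y).IsConst := by
  intro i
  constructor
  · intro f g h
    have h' : ∀ j (hj : j ≤ i), f.1 j (Nat.le_succ_of_le hj) = g.1 j (Nat.le_succ_of_le hj) :=
      fun j hj => congrFun (congrFun (congrArg Subtype.val h) j) hj
    apply Subtype.ext
    funext j hj x
    rcases Nat.le_succ_iff.mp hj with hj' | rfl
    · rw [h' j hj']
    · apply (hY i).1
      rw [← f.2 i hj x, ← g.2 i hj x, h' i le_rfl]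
  · intro f
    let top : X.obj (i + 1) → Y.obj (i + 1) :=
      fun x => ((hY i).2 (f.1 i le_rfl (X.res i x))).choose
    have htop : ∀ x, Y.res i (top x) = f.1 i le_rfl (X.res i x) :=
      fun x => ((hY i).2 (f.1 i le_rfl (X.res i x))).choose_spec
    let F : ∀ j, j ≤ i + 1 → X.obj j → Y.obj j := fun j hj =>
      if h : j ≤ i then f.1 j h
      else (show i + 1 = j by omega) ▸ top
    have F1 : ∀ j (hj : j ≤ i), F j (Nat.le_succ_of_le hj) = f.1 j hj := fun j hj => dif_pos hj
    have F2 : F (i + 1) le_rfl = top := dif_neg (by omega)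
    refine ⟨⟨F, ?_⟩, ?_⟩
    · intro j h x
      rcases Nat.le_succ_iff.mp h with h' | h'
      · rw [F1 _ h', F1 _ (Nat.le_of_succ_le h')]
        exact f.2 j h' x
      · obtain rfl : j = i := by omega
        rw [F1 _ le_rfl, F2, htop]
    · apply Subtype.ext
      funext j hj
      exact F1 j hj

/-! ### Truncations and fixed points of operations on objects -/

/-- The first `n` stages of an object. -/
@[ext]
structure Trunc (n : ℕ) where
  obj : ∀ i, i < n → Type
  res : ∀ i (h : i + 1 < n), obj (i + 1) h → obj i (Nat.lt_of_succ_lt h)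

/-- Forget all stages but the first `n`. -/
def trunc (n : ℕ) (X : Tree) : Trunc n where
  obj i _ := X.obj i
  res i _ := X.res i

theorem trunc_mono {m n : ℕ} (h : m ≤ n) {X Y : Tree} (e : trunc n X = trunc n Y) :
    trunc m X = trunc m Y :=
  congrArg (fun T : Trunc n => (⟨fun i hi => T.obj i (lt_of_lt_of_le hi h),
    fun i hi => T.res i (lt_of_lt_of_le hi h)⟩ : Trunc m)) e

theorem obj_eq_of_trunc {n : ℕ} {X Y : Tree} (e : trunc n X = trunc n Y) {i : ℕ} (h : i < n) :
    X.obj i = Y.obj i :=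
  congrArg (fun T : Trunc n => T.obj i h) e

theorem res_heq_of_trunc {n : ℕ} {X Y : Tree} (e : trunc n X = trunc n Y) {i : ℕ}
    (h : i + 1 < n) : HEq (X.res i) (Y.res i) := by
  have : ∀ T T' : Trunc n, T = T' → HEq (T.res i h) (T'.res i h) := by
    rintro T _ rfl; rfl
  exact this _ _ e

theorem trunc_ext {n : ℕ} {X Y : Tree} (ho : ∀ i, i < n → X.obj i = Y.obj i)
    (hr : ∀ i, i + 1 < n → HEq (X.res i) (Y.res i)) : trunc n X = trunc n Y := by
  apply Trunc.ext
  · funext i h; exact ho i h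
  · refine Function.hfunext rfl ?_
    rintro i _ ⟨⟩
    refine Function.hfunext rfl ?_
    rintro h _ ⟨⟩
    exact hr i h

theorem trunc_zero (X Y : Tree) : trunc 0 X = trunc 0 Y :=
  trunc_ext (fun _ h => absurd h (Nat.not_lt_zero _)) fun _ h => absurd h (Nat.not_lt_zero _)

theorem eq_of_trunc {X Y : Tree} (h : ∀ n, trunc n X = trunc n Y) : X = Y := by
  apply Tree.ext
  · funext i; exact obj_eq_of_trunc (h (i + 1)) (Nat.lt_succ_self i)
  · refine Function.hfunext rfl ?_
    rintro i _ ⟨⟩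
    exact res_heq_of_trunc (h (i + 2)) (Nat.lt_succ_self _)

theorem trunc_prod {n : ℕ} {X X' Y Y' : Tree} (hX : trunc n X = trunc n X')
    (hY : trunc n Y = trunc n Y') : trunc n (prod X Y) = trunc n (prod X' Y') :=
  congrArg₂ (fun S T : Trunc n => (⟨fun i h => S.obj i h × T.obj i h,
    fun i h => Prod.map (S.res i h) (T.res i h)⟩ : Trunc n)) hX hY

theorem trunc_sum {n : ℕ} {X X' Y Y' : Tree} (hX : trunc n X = trunc n X')
    (hY : trunc n Y = trunc n Y') : trunc n (sum X Y) = trunc n (sum X' Y') :=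
  congrArg₂ (fun S T : Trunc n => (⟨fun i h => S.obj i h ⊕ T.obj i h,
    fun i h => Sum.map (S.res i h) (T.res i h)⟩ : Trunc n)) hX hY

theorem trunc_exp {n : ℕ} {X X' Y Y' : Tree} (hX : trunc n X = trunc n X')
    (hY : trunc n Y = trunc n Y') : trunc n (exp X Y) = trunc n (exp X' Y') :=
  congrArg₂ (fun S T : Trunc n => (⟨fun i hi =>
      {f : ∀ j (h : j ≤ i), S.obj j (lt_of_le_of_lt h hi) → T.obj j (lt_of_le_of_lt h hi) //
        ∀ j (h : j + 1 ≤ i) (x : S.obj (j + 1) (lt_of_le_of_lt h hi)),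
          f j (Nat.le_of_succ_le h) (S.res j (lt_of_le_of_lt h hi) x) =
            T.res j (lt_of_le_of_lt h hi) (f (j + 1) h x)},
    fun _ _ f => ⟨fun j h => f.1 j (Nat.le_succ_of_le h),
      fun j h => f.2 j (Nat.le_succ_of_le h)⟩⟩ : Trunc n)) hX hY

theorem trunc_later {n : ℕ} {X Y : Tree} (h : trunc n X = trunc n Y) :
    trunc (n + 1) (later X) = trunc (n + 1) (later Y) := by
  apply trunc_ext
  · rintro (_ | i) hi
    · rfl
    · exact obj_eq_of_trunc h (Nat.lt_of_succ_lt_succ hi)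
  · rintro (_ | i) hi
    · have e : X.obj 0 = Y.obj 0 := obj_eq_of_trunc h (Nat.lt_of_succ_lt_succ hi)
      refine Function.hfunext e ?_
      intro _ _ _; rfl
    · exact res_heq_of_trunc h (Nat.lt_of_succ_lt_succ hi)

/-- An operation on objects is contractive if the first `n + 1` stages of its value depend only
on the first `n` stages of its argument. -/
def Contractive (G : Tree → Tree) : Prop :=
  ∀ n X Y, trunc n X = trunc n Y → trunc (n + 1) (G X) = trunc (n + 1) (G Y)

theorem Contractive.exists_fix {G : Tree → Tree} (hG : Contractive G) : ∃ X, G X = X := by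
  let x : ℕ → Tree := fun k => G^[k] (const Unit)
  have xs : ∀ k, x (k + 1) = G (x k) := fun k => Function.iterate_succ_apply' G k _
  have step : ∀ k, trunc k (x k) = trunc k (x (k + 1)) := by
    intro k
    induction k with
    | zero => exact trunc_zero _ _
    | succ k ih => rw [xs k, xs (k + 1)]; exact hG _ _ _ ih
  have coh : ∀ k l, k ≤ l → trunc k (x k) = trunc k (x l) := by
    intro k l h
    induction l, h using Nat.le_induction with
    | base => rfl
    | succ l h ih => exact ih.trans (trunc_mono h (step l))
  let L : Tree :=
    { obj := fun i => (x (i + 1)).obj i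
      res := fun i => cast (by
        rw [obj_eq_of_trunc (step (i + 1)) (Nat.lt_succ_self i)]) ((x (i + 2)).res i) }
  have hL : ∀ n, trunc n L = trunc n (x n) := by
    intro n
    apply trunc_ext
    · intro i hi
      exact obj_eq_of_trunc (coh (i + 1) n hi) (Nat.lt_succ_self i)
    · intro i hi
      exact (cast_heq _ _).trans (res_heq_of_trunc (coh (i + 2) n hi) (Nat.lt_succ_self _))
  refine ⟨L, eq_of_trunc ?_⟩
  rintro (_ | n)
  · exact trunc_zero _ _
  · rw [hL (n + 1), xs n]; exact hG _ _ _ (hL n)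

open Classical in
/-- A solution `X` of `G X = X` (the terminal object if there is none). A contractive `G` has
exactly one solution. -/
noncomputable def fixObj (G : Tree → Tree) : Tree :=
  if h : ∃ X, G X = X then h.choose else const Unit

theorem Contractive.fixObj_eq {G : Tree → Tree} (hG : Contractive G) :
    G (fixObj G) = fixObj G := by
  have h := hG.exists_fix
  have e : fixObj G = h.choose := dif_pos h
  rw [e]
  exact h.choose_spec

theorem Contractive.unique {G : Tree → Tree} (hG : Contractive G) {X Y : Tree}
    (hX : G X = X) (hY : G Y = Y) : X = Y := by
  apply eq_of_trunc
  intro n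
  induction n with
  | zero => exact trunc_zero _ _
  | succ n ih =>
    have := hG n X Y ih
    rwa [hX, hY] at this

end Tree

/-! ### Arrows -/

namespace Hom

def id (X : Tree) : Hom X X where
  app _ x := x
  natural _ _ := rfl

def comp {X Y Z : Tree} (g : Hom Y Z) (f : Hom X Y) : Hom X Z where
  app i x := g.app i (f.app i x)
  natural i x := by rw [f.natural, g.natural]

/-- The identity arrow between objects that are equal. -/
def ofEq {X Y : Tree} (h : X = Y) : Hom X Y := h ▸ Hom.id X

theorem app_restr {X Y : Tree} (f : Hom X Y) {j i : ℕ} (h : j ≤ i) (x : X.obj i) :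
    f.app j (X.restr h x) = Y.restr h (f.app i x) := by
  induction i, h using Nat.le_induction with
  | base => rw [X.restr_self, Y.restr_self]
  | succ i h ih => rw [X.restr_succ h, Y.restr_succ h, ih, f.natural]

/-- The constant arrow with value `z`. -/
def point {X : Tree} {Z : Type} (z : Z) : Hom X (Tree.const Z) where
  app _ _ := z
  natural _ _ := rfl

def mapConst {Y Z : Type} (h : Y → Z) : Hom (Tree.const Y) (Tree.const Z) where
  app _ := h
  natural _ _ := rfl

def pair {X Y Z : Tree} (f : Hom X Y) (g : Hom X Z) : Hom X (Tree.prod Y Z) where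
  app i x := (f.app i x, g.app i x)
  natural i x := Prod.ext (f.natural i x) (g.natural i x)

def fst {X Y : Tree} : Hom (Tree.prod X Y) X where
  app _ p := p.1
  natural _ _ := rfl

def snd {X Y : Tree} : Hom (Tree.prod X Y) Y where
  app _ p := p.2
  natural _ _ := rfl

def inl {X Y : Tree} : Hom X (Tree.sum X Y) where
  app _ x := Sum.inl x
  natural _ _ := rfl

def inr {X Y : Tree} : Hom Y (Tree.sum X Y) where
  app _ y := Sum.inr y
  natural _ _ := rfl

/-- The unique arrow out of the initial object. -/
def absurd {X : Tree} : Hom (Tree.const Empty) X where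
  app _ x := x.elim
  natural _ x := x.elim

/-- Case distinction in a context `Γ`. -/
def cases {Γ X Y Z : Tree} (t : Hom Γ (Tree.sum X Y)) (l : Hom (Tree.prod X Γ) Z)
    (r : Hom (Tree.prod Y Γ) Z) : Hom Γ Z where
  app i γ := Sum.elim (fun x => l.app i (x, γ)) (fun y => r.app i (y, γ)) (t.app i γ)
  natural i γ := by
    rw [t.natural]
    cases t.app (i + 1) γ with
    | inl x => exact l.natural i (x, γ)
    | inr y => exact r.natural i (y, γ)

/-- Abstraction: at stage `i` and for `j ≤ i` it sends `a` to the value at stage `j`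
on `a` and the restriction of `γ`. -/
def curry {Γ X Y : Tree} (f : Hom (Tree.prod X Γ) Y) : Hom Γ (Tree.exp X Y) where
  app i γ := ⟨fun j h a => f.app j (a, Γ.restr h γ), fun j h a => by
    change f.app j (X.res j a, Γ.restr (Nat.le_of_succ_le h) γ) = _
    rw [← Γ.res_restr h]
    exact f.natural j (a, Γ.restr h γ)⟩
  natural i γ := by
    apply Subtype.ext
    funext j h a
    change f.app j (a, Γ.restr h (Γ.res i γ)) = f.app j (a, Γ.restr (Nat.le_succ_of_le h) γ)
    rw [Γ.restr_succ h]

def eval {X Y : Tree} : Hom (Tree.prod (Tree.exp X Y) X) Y where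
  app i p := p.1.1 i le_rfl p.2
  natural i p := p.1.2 i le_rfl p.2

/-- The components of `next`. -/
def nextApp (X : Tree) : ∀ i, X.obj i → X.later.obj i
  | 0 => fun _ => ()
  | i + 1 => X.res i

/-- The natural transformation `next : X → ▶ X`. -/
def next {X : Tree} : Hom X X.later where
  app := nextApp X
  natural i x := by cases i <;> rfl

/-- The components of `⊛`. -/
def apApp (X Y : Tree) : ∀ i, (Tree.exp X Y).later.obj i → X.later.obj i → Y.later.obj i
  | 0 => fun _ _ => ()
  | i + 1 => fun f x => f.1 i le_rfl x

/-- The arrow `▶ (Y ^ X) × ▶ X → ▶ Y` that interprets `⊛`. -/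
def ap {X Y : Tree} : Hom (Tree.prod (Tree.exp X Y).later X.later) Y.later where
  app i p := apApp X Y i p.1 p.2
  natural i p := by
    cases i with
    | zero => rfl
    | succ i => exact p.1.2 i le_rfl p.2

/-- The counit `■ X → X`. -/
def unbox {X : Tree} : Hom X.box X where
  app i x := x.1 i
  natural i x := (x.2 i).symm

/-- The global element of `Y` that an arrow `X → Y` makes from one of `X`. -/
def onGlobal {X Y : Tree} (f : Hom X Y) (x : X.Global) : Y.Global :=
  ⟨fun i => f.app i (x.1 i), fun i => by rw [← f.natural, x.2]⟩

/-- From `t : X → ▶ Y` with `X` constant, the arrow `X → Y` whose value at stage `i`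
is the value of `t` at stage `i + 1`. -/
noncomputable def prev {X Y : Tree} (hX : X.IsConst) (t : Hom X Y.later) : Hom X Y where
  app i x := t.app (i + 1) ((hX.global i x).1 (i + 1))
  natural i x := by
    rw [hX.global_res, ← (hX.global (i + 1) x).2 (i + 1), t.natural]; rfl

/-- From `t : X → Y` with `X` constant, the arrow `X → ■ Y`. -/
noncomputable def box {X Y : Tree} (hX : X.IsConst) (t : Hom X Y) : Hom X Y.box where
  app i x := t.onGlobal (hX.global i x)
  natural i x := by rw [hX.global_res]; rfl

theorem isLeft_global {X Y : Tree} (g : (Tree.sum X Y).Global) (i : ℕ) :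
    (g.1 i).isLeft = (g.1 0).isLeft := by
  induction i with
  | zero => rfl
  | succ i ih =>
    rw [← ih, ← g.2 i]
    exact (Sum.isLeft_map _ _ _).symm

theorem map_getLeft {S T S' T' : Type} {f : S → S'} {g : T → T'} {s : S ⊕ T} {t : S' ⊕ T'}
    (e : Sum.map f g s = t) (hs : s.isLeft = true) (ht : t.isLeft = true) :
    f (s.getLeft hs) = t.getLeft ht := by
  subst e
  cases s with
  | inl x => rfl
  | inr y => cases hs

theorem map_getRight {S T S' T' : Type} {f : S → S'} {g : T → T'} {s : S ⊕ T} {t : S' ⊕ T'}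
    (e : Sum.map f g s = t) (hs : s.isRight = true) (ht : t.isRight = true) :
    g (s.getRight hs) = t.getRight ht := by
  subst e
  cases s with
  | inl x => cases hs
  | inr y => rfl

open Classical in
/-- A global element of a coproduct is a global element of one of the summands. -/
noncomputable def splitGlobal {X Y : Tree} (g : (Tree.sum X Y).Global) : X.Global ⊕ Y.Global :=
  if h : (g.1 0).isLeft = true then
    Sum.inl ⟨fun i => (g.1 i).getLeft ((isLeft_global g i).trans h), fun i =>
      map_getLeft (g.2 i) _ _⟩
  else
    have hr : ∀ i, (g.1 i).isRight = true := fun i =>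
      Sum.not_isLeft.mp fun e => h ((isLeft_global g i).symm.trans e)
    Sum.inr ⟨fun i => (g.1 i).getRight (hr i), fun i =>
      map_getRight (g.2 i) _ _⟩

/-- From `t : X → Y + Z` with `X` constant, the arrow `X → ■ Y + ■ Z`. -/
noncomputable def boxSum {X Y Z : Tree} (hX : X.IsConst) (t : Hom X (Tree.sum Y Z)) :
    Hom X (Tree.sum Y.box Z.box) where
  app i x := splitGlobal (t.onGlobal (hX.global i x))
  natural i x := by
    rw [hX.global_res]
    change _ = Sum.map _root_.id _root_.id _
    rw [Sum.map_id_id]; rfl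

end Hom

/-! ## Types -/

/-- Raw types with type variables among `Fin n` (de Bruijn indices). Since `■` may only be
applied to closed types, its argument has no variables. -/
inductive Ty : ℕ → Type
  | var {n} (i : Fin n) : Ty n
  | nat {n} : Ty n
  | one {n} : Ty n
  | prod {n} (A B : Ty n) : Ty n
  | empty {n} : Ty n
  | sum {n} (A B : Ty n) : Ty n
  | arr {n} (A B : Ty n) : Ty n
  | mu {n} (A : Ty (n + 1)) : Ty n
  | later {n} (A : Ty n) : Ty n
  | box {n} (A : Ty 0) : Ty n

namespace Ty

/-- All occurrences of the variable `k` are beneath a `▶`. -/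
def Guarded : {n : ℕ} → Fin n → Ty n → Prop
  | _, k, var i => i ≠ k
  | _, _, nat => True
  | _, _, one => True
  | _, k, prod A B => Guarded k A ∧ Guarded k B
  | _, _, empty => True
  | _, k, sum A B => Guarded k A ∧ Guarded k B
  | _, k, arr A B => Guarded k A ∧ Guarded k B
  | _, k, mu A => Guarded k.succ A
  | _, _, later _ => True
  | _, _, box _ => True

/-- The type formation judgment: each `μ` binds a guarded variable. -/
def Formed : {n : ℕ} → Ty n → Prop
  | _, var _ => True
  | _, nat => True
  | _, one => True
  | _, prod A B => Formed A ∧ Formed B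
  | _, empty => True
  | _, sum A B => Formed A ∧ Formed B
  | _, arr A B => Formed A ∧ Formed B
  | _, mu A => Formed A ∧ Guarded 0 A
  | _, later A => Formed A
  | _, box A => Formed A

/-- All occurrences of `▶` are beneath a `■`. -/
def Constant : {n : ℕ} → Ty n → Prop
  | _, var _ => True
  | _, nat => True
  | _, one => True
  | _, prod A B => Constant A ∧ Constant B
  | _, empty => True
  | _, sum A B => Constant A ∧ Constant B
  | _, arr A B => Constant A ∧ Constant B
  | _, mu A => Constant A
  | _, later _ => False
  | _, box _ => True

/-- Extend a renaming under a binder. -/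
def liftRen {m n : ℕ} (ξ : Fin m → Fin n) : Fin (m + 1) → Fin (n + 1) :=
  Fin.cons 0 (fun i => (ξ i).succ)

def rename : {m n : ℕ} → (Fin m → Fin n) → Ty m → Ty n
  | _, _, ξ, var i => var (ξ i)
  | _, _, _, nat => nat
  | _, _, _, one => one
  | _, _, ξ, prod A B => prod (rename ξ A) (rename ξ B)
  | _, _, _, empty => empty
  | _, _, ξ, sum A B => sum (rename ξ A) (rename ξ B)
  | _, _, ξ, arr A B => arr (rename ξ A) (rename ξ B)
  | _, _, ξ, mu A => mu (rename (liftRen ξ) A)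
  | _, _, ξ, later A => later (rename ξ A)
  | _, _, _, box A => box A

/-- Extend a substitution under a binder. -/
def liftSub {m n : ℕ} (σ : Fin m → Ty n) : Fin (m + 1) → Ty (n + 1) :=
  Fin.cons (var 0) (fun i => rename Fin.succ (σ i))

/-- Simultaneous capture-avoiding substitution. -/
def subst : {m n : ℕ} → (Fin m → Ty n) → Ty m → Ty n
  | _, _, σ, var i => σ i
  | _, _, _, nat => nat
  | _, _, _, one => one
  | _, _, σ, prod A B => prod (subst σ A) (subst σ B)
  | _, _, _, empty => empty
  | _, _, σ, sum A B => sum (subst σ A) (subst σ B)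
  | _, _, σ, arr A B => arr (subst σ A) (subst σ B)
  | _, _, σ, mu A => mu (subst (liftSub σ) A)
  | _, _, σ, later A => later (subst σ A)
  | _, _, _, box A => box A

/-- The unfolding `A[μα.A/α]`. -/
def unfolding {n : ℕ} (A : Ty (n + 1)) : Ty n := subst (Fin.cons (mu A) var) A

theorem guarded_rename : ∀ {m n : ℕ} (ξ : Fin m → Fin n) (A : Ty m) (k : Fin n),
    (∀ j, ξ j = k → Guarded j A) → Guarded k (rename ξ A)
  | _, _, ξ, var i, k, h => fun e => h i e rfl
  | _, _, _, nat, _, _ => trivial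
  | _, _, _, one, _, _ => trivial
  | _, _, ξ, prod A B, k, h =>
    ⟨guarded_rename ξ A k fun j e => (h j e).1, guarded_rename ξ B k fun j e => (h j e).2⟩
  | _, _, _, empty, _, _ => trivial
  | _, _, ξ, sum A B, k, h =>
    ⟨guarded_rename ξ A k fun j e => (h j e).1, guarded_rename ξ B k fun j e => (h j e).2⟩
  | _, _, ξ, arr A B, k, h =>
    ⟨guarded_rename ξ A k fun j e => (h j e).1, guarded_rename ξ B k fun j e => (h j e).2⟩
  | _, _, ξ, mu A, k, h => guarded_rename (liftRen ξ) A k.succ fun j => by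
    refine Fin.cases ?_ (fun j e => ?_) j
    · intro e; exact absurd e (Fin.succ_ne_zero k).symm
    · exact h j (Fin.succ_injective _ e)
  | _, _, _, later _, _, _ => trivial
  | _, _, _, box _, _, _ => trivial

theorem formed_rename : ∀ {m n : ℕ} (ξ : Fin m → Fin n) (A : Ty m),
    Formed A → Formed (rename ξ A)
  | _, _, _, var _, _ => trivial
  | _, _, _, nat, _ => trivial
  | _, _, _, one, _ => trivial
  | _, _, ξ, prod A B, h => ⟨formed_rename ξ A h.1, formed_rename ξ B h.2⟩
  | _, _, _, empty, _ => trivial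
  | _, _, ξ, sum A B, h => ⟨formed_rename ξ A h.1, formed_rename ξ B h.2⟩
  | _, _, ξ, arr A B, h => ⟨formed_rename ξ A h.1, formed_rename ξ B h.2⟩
  | _, _, ξ, mu A, h => ⟨formed_rename _ A h.1, guarded_rename _ A 0 fun j => by
      refine Fin.cases ?_ (fun j e => ?_) j
      · intro _; exact h.2
      · exact absurd e (Fin.succ_ne_zero _)⟩
  | _, _, ξ, later A, h => formed_rename ξ A h
  | _, _, _, box _, h => h

theorem subst_rename : ∀ {l m n : ℕ} (ξ : Fin l → Fin m) (σ : Fin m → Ty n) (τ : Fin l → Ty n)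
    (A : Ty l), (∀ i, σ (ξ i) = τ i) → subst σ (rename ξ A) = subst τ A
  | _, _, _, _, _, _, var i, h => h i
  | _, _, _, _, _, _, nat, _ => rfl
  | _, _, _, _, _, _, one, _ => rfl
  | _, _, _, ξ, σ, τ, prod A B, h =>
    congrArg₂ prod (subst_rename ξ σ τ A h) (subst_rename ξ σ τ B h)
  | _, _, _, _, _, _, empty, _ => rfl
  | _, _, _, ξ, σ, τ, sum A B, h =>
    congrArg₂ sum (subst_rename ξ σ τ A h) (subst_rename ξ σ τ B h)
  | _, _, _, ξ, σ, τ, arr A B, h =>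
    congrArg₂ arr (subst_rename ξ σ τ A h) (subst_rename ξ σ τ B h)
  | _, _, _, ξ, σ, τ, mu A, h =>
    congrArg mu (subst_rename (liftRen ξ) (liftSub σ) (liftSub τ) A fun i => by
      refine Fin.cases ?_ (fun i => ?_) i
      · rfl
      · exact congrArg (rename Fin.succ) (h i))
  | _, _, _, ξ, σ, τ, later A, h => congrArg later (subst_rename ξ σ τ A h)
  | _, _, _, _, _, _, box _, _ => rfl

theorem subst_var : ∀ {n : ℕ} (σ : Fin n → Ty n) (A : Ty n), (∀ i, σ i = var i) →
    subst σ A = A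
  | _, _, var i, h => h i
  | _, _, nat, _ => rfl
  | _, _, one, _ => rfl
  | _, σ, prod A B, h => congrArg₂ prod (subst_var σ A h) (subst_var σ B h)
  | _, _, empty, _ => rfl
  | _, σ, sum A B, h => congrArg₂ sum (subst_var σ A h) (subst_var σ B h)
  | _, σ, arr A B, h => congrArg₂ arr (subst_var σ A h) (subst_var σ B h)
  | _, σ, mu A, h => congrArg mu (subst_var (liftSub σ) A fun i => by
      refine Fin.cases ?_ (fun i => ?_) i
      · rfl
      · exact congrArg (rename Fin.succ) (h i))
  | _, σ, later A, h => congrArg later (subst_var σ A h)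
  | _, _, box _, _ => rfl

/-! ### Denotation of types -/

/-- The denotation of a type with `n` variables as an operation on objects. This is the object
part of the mixed-variance functor, restricted to equal objects for the negative and the positive
occurrences of each variable, which is all that the denotation of closed types uses; in
particular the denotation of `μα.A` is the solution `X` of `F (X, X) = X`. -/
noncomputable def den : {n : ℕ} → Ty n → (Fin n → Tree) → Tree
  | _, var i, ρ => ρ i
  | _, nat, _ => Tree.const ℕ
  | _, one, _ => Tree.const Unit
  | _, prod A B, ρ => Tree.prod (den A ρ) (den B ρ)
  | _, empty, _ => Tree.const Empty
  | _, sum A B, ρ => Tree.sum (den A ρ) (den B ρ)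
  | _, arr A B, ρ => Tree.exp (den A ρ) (den B ρ)
  | _, mu A, ρ => Tree.fixObj fun X => den A (Fin.cons X ρ)
  | _, later A, ρ => Tree.later (den A ρ)
  | _, box A, _ => Tree.box (den A Fin.elim0)

theorem den_rename : ∀ {m n : ℕ} (ξ : Fin m → Fin n) (A : Ty m) (ρ : Fin n → Tree),
    den (rename ξ A) ρ = den A (fun i => ρ (ξ i))
  | _, _, _, var _, _ => rfl
  | _, _, _, nat, _ => rfl
  | _, _, _, one, _ => rfl
  | _, _, ξ, prod A B, ρ => congrArg₂ Tree.prod (den_rename ξ A ρ) (den_rename ξ B ρ)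
  | _, _, _, empty, _ => rfl
  | _, _, ξ, sum A B, ρ => congrArg₂ Tree.sum (den_rename ξ A ρ) (den_rename ξ B ρ)
  | _, _, ξ, arr A B, ρ => congrArg₂ Tree.exp (den_rename ξ A ρ) (den_rename ξ B ρ)
  | _, _, ξ, mu A, ρ => congrArg Tree.fixObj <| funext fun X => by
      rw [den_rename]
      congr 1
      funext i
      refine Fin.cases ?_ (fun i => ?_) i <;> rfl
  | _, _, ξ, later A, ρ => congrArg Tree.later (den_rename ξ A ρ)
  | _, _, _, box _, _ => rfl

theorem den_subst : ∀ {m n : ℕ} (σ : Fin m → Ty n) (A : Ty m) (ρ : Fin n → Tree),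
    den (subst σ A) ρ = den A (fun i => den (σ i) ρ)
  | _, _, _, var _, _ => rfl
  | _, _, _, nat, _ => rfl
  | _, _, _, one, _ => rfl
  | _, _, σ, prod A B, ρ => congrArg₂ Tree.prod (den_subst σ A ρ) (den_subst σ B ρ)
  | _, _, _, empty, _ => rfl
  | _, _, σ, sum A B, ρ => congrArg₂ Tree.sum (den_subst σ A ρ) (den_subst σ B ρ)
  | _, _, σ, arr A B, ρ => congrArg₂ Tree.exp (den_subst σ A ρ) (den_subst σ B ρ)
  | _, _, σ, mu A, ρ => congrArg Tree.fixObj <| funext fun X => by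
      rw [den_subst]
      congr 1
      funext i
      refine Fin.cases ?_ (fun i => ?_) i
      · rfl
      · exact den_rename Fin.succ (σ i) (Fin.cons X ρ)
  | _, _, σ, later A, ρ => congrArg Tree.later (den_subst σ A ρ)
  | _, _, _, box _, _ => rfl

/-- The first `n + 1` stages of a denotation depend only on the first `n` stages of the guarded
and on the first `n + 1` stages of the other variables. -/
theorem den_trunc : ∀ {m : ℕ} (A : Ty m), Formed A → ∀ (n : ℕ) (ρ ρ' : Fin m → Tree),
    (∀ i, Tree.trunc n (ρ i) = Tree.trunc n (ρ' i)) →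
    (∀ i, ¬ Guarded i A → Tree.trunc (n + 1) (ρ i) = Tree.trunc (n + 1) (ρ' i)) →
    Tree.trunc (n + 1) (den A ρ) = Tree.trunc (n + 1) (den A ρ') := by
  intro m A
  induction A with
  | var i => intro _ n ρ ρ' _ h; exact h i (fun e => e rfl)
  | nat => intros; rfl
  | one => intros; rfl
  | empty => intros; rfl
  | box A => intros; rfl
  | prod A B ihA ihB =>
    intro hf n ρ ρ' h h'
    exact Tree.trunc_prod (ihA hf.1 n ρ ρ' h fun i hi => h' i fun g => hi g.1)
      (ihB hf.2 n ρ ρ' h fun i hi => h' i fun g => hi g.2)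
  | sum A B ihA ihB =>
    intro hf n ρ ρ' h h'
    exact Tree.trunc_sum (ihA hf.1 n ρ ρ' h fun i hi => h' i fun g => hi g.1)
      (ihB hf.2 n ρ ρ' h fun i hi => h' i fun g => hi g.2)
  | arr A B ihA ihB =>
    intro hf n ρ ρ' h h'
    exact Tree.trunc_exp (ihA hf.1 n ρ ρ' h fun i hi => h' i fun g => hi g.1)
      (ihB hf.2 n ρ ρ' h fun i hi => h' i fun g => hi g.2)
  | later A ih =>
    intro hf n ρ ρ' h _
    apply Tree.trunc_later
    cases n with
    | zero => exact Tree.trunc_zero _ _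
    | succ n =>
      exact ih hf n ρ ρ' (fun i => Tree.trunc_mono (Nat.le_succ n) (h i)) fun i _ => h i
  | mu A ih =>
    intro hf n ρ ρ' h h'
    have contr : ∀ τ, Tree.Contractive fun X => den A (Fin.cons X τ) := by
      intro τ k X Y e
      apply ih hf.1 k
      · intro i; refine Fin.cases ?_ (fun i => ?_) i
        · exact e
        · rfl
      · intro i; refine Fin.cases ?_ (fun i => ?_) i
        · intro hg; exact absurd hf.2 hg
        · intro _; rfl
    have key : ∀ k, k ≤ n + 1 → Tree.trunc k (den (mu A) ρ) = Tree.trunc k (den (mu A) ρ') := by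
      intro k
      induction k with
      | zero => intro _; exact Tree.trunc_zero _ _
      | succ k ihk =>
        intro hk
        have e := ih hf.1 k (Fin.cons (den (mu A) ρ) ρ) (Fin.cons (den (mu A) ρ') ρ')
          (by
            intro i; refine Fin.cases ?_ (fun i => ?_) i
            · exact ihk (Nat.le_of_succ_le hk)
            · exact Tree.trunc_mono (Nat.le_of_succ_le_succ hk) (h i))
          (by
            intro i; refine Fin.cases ?_ (fun i => ?_) i
            · intro hg; exact absurd hf.2 hg
            · intro hg; exact Tree.trunc_mono hk (h' i hg))
        have e1 : den A (Fin.cons (den (mu A) ρ) ρ) = den (mu A) ρ := (contr ρ).fixObj_eq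
        have e2 : den A (Fin.cons (den (mu A) ρ') ρ') = den (mu A) ρ' := (contr ρ').fixObj_eq
        rwa [e1, e2] at e
    exact key (n + 1) le_rfl

theorem den_contractive {n : ℕ} {A : Ty (n + 1)} (h : Formed (mu A)) (ρ : Fin n → Tree) :
    Tree.Contractive fun X => den A (Fin.cons X ρ) := by
  intro k X Y e
  apply den_trunc A h.1 k
  · intro i; refine Fin.cases ?_ (fun i => ?_) i
    · exact e
    · rfl
  · intro i; refine Fin.cases ?_ (fun i => ?_) i
    · intro hg; exact absurd h.2 hg
    · intro _; rfl

theorem den_mu {n : ℕ} {A : Ty (n + 1)} (h : Formed (mu A)) (ρ : Fin n → Tree) :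
    den A (Fin.cons (den (mu A) ρ) ρ) = den (mu A) ρ :=
  (den_contractive h ρ).fixObj_eq

/-- A recursive type and its unfolding have the same denotation. -/
theorem den_unfolding {n : ℕ} {A : Ty (n + 1)} (h : Formed (mu A)) (ρ : Fin n → Tree) :
    den (unfolding A) ρ = den (mu A) ρ := by
  rw [unfolding, den_subst]
  refine Eq.trans (congrArg (den A) (funext fun i => ?_)) (den_mu h ρ)
  refine Fin.cases ?_ (fun i => ?_) i <;> rfl

/-- Constant types denote constant objects. -/
theorem isConst_den : ∀ {m : ℕ} (A : Ty m), Formed A → Constant A → ∀ ρ : Fin m → Tree,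
    (∀ i, ¬ Guarded i A → (ρ i).IsConst) → (den A ρ).IsConst := by
  intro m A
  induction A with
  | var i => intro _ _ ρ h; exact h i (fun e => e rfl)
  | nat => intros; exact Tree.isConst_const _
  | one => intros; exact Tree.isConst_const _
  | empty => intros; exact Tree.isConst_const _
  | box A => intros; exact Tree.isConst_const _
  | prod A B ihA ihB =>
    intro hf hc ρ h
    exact (ihA hf.1 hc.1 ρ fun i hi => h i fun g => hi g.1).prod
      (ihB hf.2 hc.2 ρ fun i hi => h i fun g => hi g.2)
  | sum A B ihA ihB =>
    intro hf hc ρ h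
    exact (ihA hf.1 hc.1 ρ fun i hi => h i fun g => hi g.1).sum
      (ihB hf.2 hc.2 ρ fun i hi => h i fun g => hi g.2)
  | arr A B ihA ihB =>
    intro hf hc ρ h
    exact Tree.IsConst.exp (ihB hf.2 hc.2 ρ fun i hi => h i fun g => hi g.2)
  | later A ih => intro _ hc; exact hc.elim
  | mu A ih =>
    intro hf hc ρ h
    rw [← den_mu hf ρ]
    apply ih hf.1 hc
    intro i; refine Fin.cases ?_ (fun i => ?_) i
    · intro hg; exact absurd hf.2 hg
    · intro hg; exact h i hg

end Ty

/-- Types: closed and well-formed. -/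
abbrev CTy : Type := {A : Ty 0 // A.Formed}

namespace CTy

def nat : CTy := ⟨Ty.nat, trivial⟩
def one : CTy := ⟨Ty.one, trivial⟩
def empty : CTy := ⟨Ty.empty, trivial⟩
def prod (A B : CTy) : CTy := ⟨Ty.prod A.1 B.1, A.2, B.2⟩
def sum (A B : CTy) : CTy := ⟨Ty.sum A.1 B.1, A.2, B.2⟩
def arr (A B : CTy) : CTy := ⟨Ty.arr A.1 B.1, A.2, B.2⟩
def later (A : CTy) : CTy := ⟨Ty.later A.1, A.2⟩
def box (A : CTy) : CTy := ⟨Ty.box A.1, A.2⟩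

/-- The denotation of a type in the topos of trees. -/
noncomputable def den (A : CTy) : Tree := A.1.den Fin.elim0

end CTy

/-! ## Terms -/

/-- Typing contexts. -/
abbrev Ctx : Type := List CTy

/-- Variables of a given type in a context (de Bruijn indices). -/
inductive Var : Ctx → CTy → Type
  | zero {Γ : Ctx} {A : CTy} : Var (A :: Γ) A
  | succ {Γ : Ctx} {A B : CTy} (x : Var Γ A) : Var (B :: Γ) A

/-- Typed terms in context `Γ ⊢ t : A`, one constructor for each typing rule. In `prev`, `box`
and `boxSum`, `σ` is the explicit substitution: it gives a term in context `Γ` for each variable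
of the context `Δ`, whose types are constant. -/
inductive Tm : Ctx → CTy → Type
  | var {Γ : Ctx} {A : CTy} (x : Var Γ A) : Tm Γ A
  | zero {Γ : Ctx} : Tm Γ CTy.nat
  | succ {Γ : Ctx} (t : Tm Γ CTy.nat) : Tm Γ CTy.nat
  | unit {Γ : Ctx} : Tm Γ CTy.one
  | pair {Γ : Ctx} {A B : CTy} (t : Tm Γ A) (u : Tm Γ B) : Tm Γ (A.prod B)
  | fst {Γ : Ctx} {A B : CTy} (t : Tm Γ (A.prod B)) : Tm Γ A
  | snd {Γ : Ctx} {A B : CTy} (t : Tm Γ (A.prod B)) : Tm Γ B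
  | abort {Γ : Ctx} {A : CTy} (t : Tm Γ CTy.empty) : Tm Γ A
  | inl {Γ : Ctx} {A B : CTy} (t : Tm Γ A) : Tm Γ (A.sum B)
  | inr {Γ : Ctx} {A B : CTy} (t : Tm Γ B) : Tm Γ (A.sum B)
  | case {Γ : Ctx} {A B C : CTy} (t : Tm Γ (A.sum B)) (l : Tm (A :: Γ) C)
      (r : Tm (B :: Γ) C) : Tm Γ C
  | lam {Γ : Ctx} {A B : CTy} (t : Tm (A :: Γ) B) : Tm Γ (A.arr B)
  | app {Γ : Ctx} {A B : CTy} (t : Tm Γ (A.arr B)) (u : Tm Γ A) : Tm Γ B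
  | fold {Γ : Ctx} {A : Ty 1} (hA : (Ty.mu A).Formed) {B : CTy} (hB : B.1 = A.unfolding)
      (t : Tm Γ B) : Tm Γ ⟨Ty.mu A, hA⟩
  | unfold {Γ : Ctx} {A : Ty 1} (hA : (Ty.mu A).Formed) {B : CTy} (hB : B.1 = A.unfolding)
      (t : Tm Γ ⟨Ty.mu A, hA⟩) : Tm Γ B
  | next {Γ : Ctx} {A : CTy} (t : Tm Γ A) : Tm Γ A.later
  | prev {Γ : Ctx} {A : CTy} (Δ : Ctx) (hΔ : ∀ B ∈ Δ, B.1.Constant)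
      (σ : ∀ B, Var Δ B → Tm Γ B) (t : Tm Δ A.later) : Tm Γ A
  | ap {Γ : Ctx} {A B : CTy} (t : Tm Γ (A.arr B).later) (u : Tm Γ A.later) : Tm Γ B.later
  | box {Γ : Ctx} {A : CTy} (Δ : Ctx) (hΔ : ∀ B ∈ Δ, B.1.Constant)
      (σ : ∀ B, Var Δ B → Tm Γ B) (t : Tm Δ A) : Tm Γ A.box
  | unbox {Γ : Ctx} {A : CTy} (t : Tm Γ A.box) : Tm Γ A
  | boxSum {Γ : Ctx} {A B : CTy} (Δ : Ctx) (hΔ : ∀ C ∈ Δ, C.1.Constant)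
      (σ : ∀ C, Var Δ C → Tm Γ C) (t : Tm Δ (A.sum B)) : Tm Γ (A.box.sum B.box)

/-! ### Denotation of terms -/

/-- The denotation of a context: the product of the denotations of its types. -/
noncomputable def Ctx.den : Ctx → Tree
  | [] => Tree.const Unit
  | A :: Γ => Tree.prod A.den (Ctx.den Γ)

/-- The denotation of a variable: a projection. -/
noncomputable def Var.den : {Γ : Ctx} → {A : CTy} → Var Γ A → Hom (Ctx.den Γ) A.den
  | _, _, .zero => Hom.fst
  | _, _, .succ x => (Var.den x).comp Hom.snd

/-- The tuple of a family of arrows into the types of a context. -/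
noncomputable def Ctx.tuple {X : Tree} : (Δ : Ctx) → (∀ B, Var Δ B → Hom X B.den) →
    Hom X (Ctx.den Δ)
  | [], _ => Hom.point ()
  | A :: Δ, s => Hom.pair (s A .zero) (Ctx.tuple Δ fun B x => s B (.succ x))

theorem Ctx.isConst_den : (Δ : Ctx) → (∀ B ∈ Δ, B.1.Constant) → (Ctx.den Δ).IsConst
  | [], _ => Tree.isConst_const _
  | A :: Δ, h => Tree.IsConst.prod
      (Ty.isConst_den A.1 A.2 (h A List.mem_cons_self) _ fun i => i.elim0)
      (Ctx.isConst_den Δ fun B hB => h B (List.mem_cons_of_mem _ hB))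

theorem CTy.den_unfolding {A : Ty 1} (hA : (Ty.mu A).Formed) {B : CTy}
    (hB : B.1 = A.unfolding) : B.den = CTy.den ⟨Ty.mu A, hA⟩ := by
  unfold CTy.den
  rw [hB, Ty.den_unfolding hA]

/-- The denotation of a term in context, an arrow in the topos of trees. -/
noncomputable def Tm.den : {Γ : Ctx} → {A : CTy} → Tm Γ A → Hom (Ctx.den Γ) A.den
  | _, _, .var x => x.den
  | _, _, .zero => Hom.point (0 : ℕ)
  | _, _, .succ t => (Hom.mapConst Nat.succ).comp t.den
  | _, _, .unit => Hom.point ()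
  | _, _, .pair t u => Hom.pair t.den u.den
  | _, _, .fst t => Hom.fst.comp t.den
  | _, _, .snd t => Hom.snd.comp t.den
  | _, _, .abort t => Hom.absurd.comp t.den
  | _, _, .inl t => Hom.inl.comp t.den
  | _, _, .inr t => Hom.inr.comp t.den
  | _, _, .case t l r => Hom.cases t.den l.den r.den
  | _, _, .lam t => Hom.curry t.den
  | _, _, .app t u => Hom.eval.comp (Hom.pair t.den u.den)
  | _, _, .fold hA hB t => (Hom.ofEq (CTy.den_unfolding hA hB)).comp t.den
  | _, _, .unfold hA hB t => (Hom.ofEq (CTy.den_unfolding hA hB).symm).comp t.den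
  | _, _, .next t => Hom.next.comp t.den
  | _, _, .prev Δ hΔ σ t =>
      (Hom.prev (Ctx.isConst_den Δ hΔ) t.den).comp (Ctx.tuple Δ fun B x => (σ B x).den)
  | _, _, .ap t u => Hom.ap.comp (Hom.pair t.den u.den)
  | _, _, .box Δ hΔ σ t =>
      (Hom.box (Ctx.isConst_den Δ hΔ) t.den).comp (Ctx.tuple Δ fun B x => (σ B x).den)
  | _, _, .unbox t => Hom.unbox.comp t.den
  | _, _, .boxSum Δ hΔ σ t =>
      (Hom.boxSum (Ctx.isConst_den Δ hΔ) t.den).comp (Ctx.tuple Δ fun B x => (σ B x).den)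

/-! ### The guarded Turing combinator -/

/-- The body `▶α → (▶A → A) → A` of the recursive type `Rec A`. -/
def recBody (A : CTy) : Ty 1 :=
  Ty.arr (Ty.later (Ty.var 0))
    (Ty.arr (Ty.arr (Ty.later (Ty.rename Fin.elim0 A.1)) (Ty.rename Fin.elim0 A.1))
      (Ty.rename Fin.elim0 A.1))

theorem recBody_formed (A : CTy) : (Ty.mu (recBody A)).Formed := by
  have h : (Ty.rename Fin.elim0 A.1 : Ty 1).Formed := Ty.formed_rename _ _ A.2
  have g : Ty.Guarded (0 : Fin 1) (Ty.rename Fin.elim0 A.1) :=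
    Ty.guarded_rename _ _ _ fun j => j.elim0
  exact ⟨⟨trivial, ⟨h, h⟩, h⟩, trivial, ⟨trivial, g⟩, g⟩

/-- `Rec A = μα.(▶α → (▶A → A) → A)`. -/
def Rec (A : CTy) : CTy := ⟨Ty.mu (recBody A), recBody_formed A⟩

/-- The type `▶(Rec A) → (▶A → A) → A`. -/
def recUnfolded (A : CTy) : CTy := (Rec A).later.arr ((A.later.arr A).arr A)

theorem recUnfolded_eq (A : CTy) : (recUnfolded A).1 = (recBody A).unfolding := by
  have h : ∀ σ : Fin 1 → Ty 0, Ty.subst σ (Ty.rename Fin.elim0 A.1) = A.1 := fun σ => by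
    rw [Ty.subst_rename Fin.elim0 σ Ty.var A.1 fun i => i.elim0]
    exact Ty.subst_var _ _ fun _ => rfl
  simp [recUnfolded, recBody, Ty.unfolding, Ty.subst, h, CTy.arr, CTy.later, Rec]

/-- `θ = λy.λf. f ((next (λz. unfold z)) ⊛ y ⊛ next y ⊛ next f)`. -/
def theta (Γ : Ctx) (A : CTy) : Tm Γ (recUnfolded A) :=
  .lam (.lam (.app (.var .zero)
    (.ap (.ap (.ap
      (.next (.lam (.unfold (recBody_formed A) (recUnfolded_eq A) (.var .zero))))
      (.var (.succ .zero)))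
      (.next (.var (.succ .zero))))
      (.next (.var .zero)))))

/-- The guarded Turing fixed point combinator `Θ = θ (next (fold θ))`. -/
def turing (Γ : Ctx) (A : CTy) : Tm Γ ((A.later.arr A).arr A) :=
  .app (theta Γ A) (.next (.fold (recBody_formed A) (recUnfolded_eq A) (theta Γ A)))

/-! ## The internal logic -/

/-- A proposition in context `Γ`: a subobject of the denotation of `Γ`. -/
structure Proposition (Γ : Ctx) where
  holds : ∀ i, Set ((Ctx.den Γ).obj i)
  closed : ∀ i γ, γ ∈ holds (i + 1) → (Ctx.den Γ).res i γ ∈ holds i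

/-- The proposition `t =_A u`: the pullback along `(t, u)` of the diagonal of `A`. -/
def Tm.eq {Γ : Ctx} {A : CTy} (t u : Tm Γ A) : Proposition Γ where
  holds i := {γ | t.den.app i γ = u.den.app i γ}
  closed i γ h := by
    change t.den.app i _ = u.den.app i _
    rw [t.den.natural, u.den.natural]
    exact congrArg _ h

/-- The entailment `Γ | Ξ ⊢ φ`: the intersection of the subobjects in `Ξ` is contained in `φ`. -/
def Entails {Γ : Ctx} (Ξ : Set (Proposition Γ)) (φ : Proposition Γ) : Prop :=
  ∀ i γ, (∀ ψ ∈ Ξ, γ ∈ ψ.holds i) → γ ∈ φ.holds i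

end GLam

namespace GLam

/-! Both halves rest on the fact that `▶` delays by one stage: `▶A` has a single element at stage
`0`, and at stage `i + 1` its elements are those of `A` at stage `i`.

The fixed point equation is a calculation in the model, with no induction on stages. Two β-steps
(`theta_app_self`) turn `fix f` into the body of `θ`, with `y` the value of `next (fold θ)`. At
stage `0` both sides apply `f` to the only element of `▶A`. At stage `i + 1` the argument of `f` is,
by `thetaBody_app_succ`, the unfolding of `y` applied at stage `i` to the restrictions of `y` and
`f`. Since `fold` and `unfold` cancel, this is `θ (next (fold θ)) f` at stage `i` on the restricted
environment, which by naturality is the value of `next (fix f)` at stage `i + 1`.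

Uniqueness is induction on stages: `f (next u)` at stage `i + 1` sees only the restriction of `u` to
stage `i`, so two solutions that agree at stage `i` agree at stage `i + 1`. Assumptions survive the
descent because propositions are closed under restriction. -/

/-- This is the β-rule `unfold (fold t) = t`: a recursive type and its unfolding denote equal
objects, and both operations are transports along that equality. -/
theorem Hom.ofEq_symm_ofEq {X Y : Tree} (h : X = Y) (i : ℕ) (x : X.obj i) :
    (Hom.ofEq h.symm).app i ((Hom.ofEq h).app i x) = x := by
  subst h; rfl

/-- The semantic β-rule. `Hom.eval` uses a function only at its own stage, where the restriction
that `Hom.curry` applies to the environment is the identity. -/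
theorem Hom.curry_app_self {Γ X Y : Tree} (f : Hom (Tree.prod X Γ) Y) (i : ℕ) (γ : Γ.obj i)
    (a : X.obj i) : ((Hom.curry f).app i γ).1 i le_rfl a = f.app i (a, γ) := by
  change f.app i (a, Γ.restr le_rfl γ) = _
  rw [Γ.restr_self]

/-- The body of `θ`, without its two abstractions. -/
def thetaBody (Γ : Ctx) (A : CTy) :
    Tm (A.later.arr A :: (Rec A).later :: Γ) A :=
  .app (.var .zero)
    (.ap (.ap (.ap
      (.next (.lam (.unfold (recBody_formed A) (recUnfolded_eq A) (.var .zero))))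
      (.var (.succ .zero)))
      (.next (.var (.succ .zero))))
      (.next (.var .zero)))

theorem theta_app_self (Γ : Ctx) (A : CTy) (i : ℕ) (γ : (Ctx.den Γ).obj i)
    (y : (Rec A).later.den.obj i) (g : (A.later.arr A).den.obj i) :
    (((theta Γ A).den.app i γ).1 i le_rfl y).1 i le_rfl g =
      (thetaBody Γ A).den.app i (g, y, γ) := by
  -- The outer β-step leaves the inner abstraction closed over the environment `(y, γ)`; the second
  -- step then supplies `g`.
  have h := Hom.curry_app_self (Hom.curry (thetaBody Γ A).den) i γ y
  exact (congrArg (fun k : ((A.later.arr A).arr A).den.obj i => k.1 i le_rfl g) h).trans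
    (Hom.curry_app_self (thetaBody Γ A).den i (y, γ) g)

theorem CTy.unfold_eq (A : CTy) : (recUnfolded A).den = (Rec A).den :=
  CTy.den_unfolding (recBody_formed A) (recUnfolded_eq A)

/-- At stage `i + 1` each `⊛` is evaluation at stage `i` and each `next` is a restriction. The first
`y` is already an element of `Rec A` at stage `i`; the second stands under `next` and so is
restricted within `▶(Rec A)`. -/
theorem thetaBody_app_succ (Γ : Ctx) (A : CTy) (i : ℕ) (γ : (Ctx.den Γ).obj (i + 1))
    (y : (Rec A).den.obj i) (g : (A.later.arr A).den.obj (i + 1)) :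
    (thetaBody Γ A).den.app (i + 1) (g, y, γ) = g.1 (i + 1) le_rfl
      ((((show (recUnfolded A).den.obj i from
        (Hom.ofEq (CTy.unfold_eq A).symm).app i y).1 i le_rfl
          ((Rec A).later.den.res i y)).1 i le_rfl ((A.later.arr A).den.res i g) : A.den.obj i)) := by
  -- The only β-redex is `λz. unfold z`. It stands under `next`, so its environment is restricted to
  -- stage `i`; everything else holds by definitional unfolding.
  have h := Hom.curry_app_self
    ((Hom.ofEq (CTy.unfold_eq A).symm).comp
      (Hom.fst : Hom (Tree.prod (Rec A).den (Ctx.den (A.later.arr A :: (Rec A).later :: Γ))) _))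
    i ((Ctx.den (A.later.arr A :: (Rec A).later :: Γ)).res i (g, y, γ)) y
  exact congrArg (fun k : (recUnfolded A).den.obj i => g.1 (i + 1) le_rfl
      ((k.1 i le_rfl ((Rec A).later.den.res i y)).1 i le_rfl
        ((A.later.arr A).den.res i g) : A.den.obj i)) h

/-- The fixed point equation `fix f = f (next (fix f))` on denotations. -/
theorem turing_app_unfold {Γ : Ctx} {A : CTy} (f : Tm Γ (A.later.arr A)) (i : ℕ)
    (γ : (Ctx.den Γ).obj i) :
    ((turing Γ A).app f).den.app i γ = (f.app ((turing Γ A).app f).next).den.app i γ := by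
  -- `F` is the denotation of `fold θ`, so `θ` receives `next F`.
  let F : Hom (Ctx.den Γ) (Rec A).den := (Hom.ofEq (CTy.unfold_eq A)).comp (theta Γ A).den
  refine (theta_app_self Γ A i γ ((Hom.next.comp F).app i γ) (f.den.app i γ)).trans ?_
  cases i with
  -- At stage `0` the set of `▶A` is `Unit`, so `f` gets the same argument on both sides.
  | zero => rfl
  | succ i =>
    refine (thetaBody_app_succ Γ A i γ ((Hom.next.comp F).app (i + 1) γ) (f.den.app (i + 1) γ)).trans
      (congrArg (fun x : A.den.obj i => (f.den.app (i + 1) γ).1 (i + 1) le_rfl x) ?_)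
    -- At stage `i + 1` the value of `next F` is the restriction of that of `F`, hence `F` at the
    -- restricted environment; unfolding it gives back `θ`.
    have hT : (Hom.ofEq (CTy.unfold_eq A).symm).app i ((Hom.next.comp F).app (i + 1) γ) =
        (theta Γ A).den.app i ((Ctx.den Γ).res i γ) :=
      (congrArg _ (F.natural i γ).symm).trans (Hom.ofEq_symm_ofEq (CTy.unfold_eq A) i _)
    -- The target argument, `next (fix f)` at stage `i + 1`, is a restriction of `fix f`. Naturality
    -- replaces it by `fix f` at stage `i` on the restricted `γ`.
    refine Eq.trans ?_ (((turing Γ A).app f).den.natural i γ)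
    have hF : (Rec A).later.den.res i ((Hom.next.comp F).app (i + 1) γ) =
        (Hom.next.comp F).app i ((Ctx.den Γ).res i γ) := ((Hom.next.comp F).natural i γ).symm
    rw [← f.den.natural, hF]
    -- With `f` and the inner `y` also moved to the restricted `γ`, replacing the unfolded `y` by
    -- `θ` yields exactly `θ (next F) f`.
    exact congrArg (fun g : (recUnfolded A).den.obj i => (g.1 i le_rfl
        ((Hom.next.comp F).app i ((Ctx.den Γ).res i γ))).1 i le_rfl
        (f.den.app i ((Ctx.den Γ).res i γ))) hT

/-- Solutions of `f (next u) = u` under given assumptions are unique. -/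
theorem Entails.fixed_point_unique {Γ : Ctx} {A : CTy} {Ξ : Set (Proposition Γ)}
    {f : Tm Γ (A.later.arr A)} {u v : Tm Γ A}
    (hu : Entails Ξ ((f.app u.next).eq u)) (hv : Entails Ξ ((f.app v.next).eq v)) :
    Entails Ξ (u.eq v) := by
  intro i
  induction i with
  | zero =>
    intro γ hγ
    -- `next u` and `next v` coincide at stage `0`, so the two equations share their left-hand side.
    exact (hu 0 γ hγ).symm.trans (hv 0 γ hγ)
  | succ i ih =>
    intro γ hγ
    have h : u.den.app i ((Ctx.den Γ).res i γ) = v.den.app i ((Ctx.den Γ).res i γ) :=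
      ih _ fun ψ hψ => ψ.closed i γ (hγ ψ hψ)
    -- The restrictions of `u` and `v` produced here are the values of `next u` and `next v` at
    -- stage `i + 1`, to which `f` is applied.
    rw [u.den.natural, v.den.natural] at h
    exact (hu _ γ hγ).symm.trans
      ((congrArg (fun x => (f.den.app (i + 1) γ).1 (i + 1) le_rfl x) h).trans (hv _ γ hγ))

end GLam

theorem lemma3p8 (Γ : GLam.Ctx) (A : GLam.CTy) (f : GLam.Tm Γ (A.later.arr A)) :
    GLam.Entails ∅ (((GLam.turing Γ A).app f).eq (f.app ((GLam.turing Γ A).app f).next)) ∧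
    ∀ (Ξ : Set (GLam.Proposition Γ)) (u : GLam.Tm Γ A),
      GLam.Entails Ξ ((f.app u.next).eq u) →
      GLam.Entails Ξ (u.eq ((GLam.turing Γ A).app f)) :=
  ⟨fun i γ _ => GLam.turing_app_unfold f i γ, fun _ _ hu =>
    -- `fix f` solves the equation under no assumptions, hence also under `Ξ`.
    hu.fixed_point_unique fun i γ _ => (GLam.turing_app_unfold f i γ).symm⟩
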